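/- Call a function $K:\mathbb{R}\to\mathbb{R}$ an admissible kernel if (i) $K\in C^\infty(\mathbb{R})$; (ii) $K(t)>0$ for all $t\in\mathbb{R}$; (iii) $K(t)=K(-t)$ for all $t\in\mathbb{R}$; (iv) $K'(t)<0$ for all $t>0$; and (v) there is $\varepsilon>0$ such that for every $n=0,1,2,\dots$, $K^{(n)}(t)=O\big(\exp(-|t|^{2+\varepsilon})\big)$ as $t\to\infty$. Call an admissible kernel $K$ strictly logarithmically concave if $\frac{d^2}{dt^2}\log K(t)<0$ for all $t>0$. Theorem. The Jacobi theta function $$\Phi(t)=\sum_{n=1}^{\infty}\pi n^2\big(2\pi n^2e^{4t}-3\big)\exp\big(5t-\pi n^2e^{4t}\big)\qquad(t\in\mathbb{R})$$ is a strictly logarithmically concave admissible kernel. Moreover, for every $n=0,1,2,\dots$, the associated kernel $$K_n(t;\Phi)=\int_{-\infty}^{\infty}\Phi(s+t)\,\Phi(s-t)\,s^{2n}\,ds\qquad(t\in\mathbb{R})$$ is also an admissible kernel. -/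

import Mathlib

open scoped ContDiff

noncomputable section

/-- Admissible kernels: smooth, positive, even functions on the real line, strictly decreasing on
the positive half-line in the sense of a negative derivative, all of whose derivatives are
`O(exp (-|t| ^ (2 + ε)))` as `t → ∞`, for one `ε > 0` that serves all orders of derivatives. -/
structure IsAdmissibleKernel (K : ℝ → ℝ) : Prop where
  smooth : ContDiff ℝ ∞ K
  pos : ∀ t : ℝ, 0 < K t
  even : ∀ t : ℝ, K t = K (-t)
  deriv_neg : ∀ t : ℝ, 0 < t → deriv K t < 0
  decay : ∃ ε : ℝ, 0 < ε ∧ ∀ n : ℕ,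
    Asymptotics.IsBigO Filter.atTop (iteratedDeriv n K) (fun t : ℝ => Real.exp (-|t| ^ (2 + ε)))

/-- Strict logarithmic concavity of a (positive) kernel `K`:
`d²/dt² log K(t) < 0` for all `t > 0`. -/
def IsStrictlyLogConcaveKernel (K : ℝ → ℝ) : Prop :=
  ∀ t : ℝ, 0 < t → iteratedDeriv 2 (fun u : ℝ => Real.log (K u)) t < 0

/-- The general term `π n² (2 π n² e^{4t} - 3) exp (5t - π n² e^{4t})`. -/
def jacobiThetaTerm (n : ℕ) (t : ℝ) : ℝ :=
  Real.pi * (n : ℝ) ^ 2 * (2 * Real.pi * (n : ℝ) ^ 2 * Real.exp (4 * t) - 3) *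
    Real.exp (5 * t - Real.pi * (n : ℝ) ^ 2 * Real.exp (4 * t))

/-- The Jacobi theta function `Φ`, the sum of the general terms over `n = 1, 2, 3, …`
(the summation index is shifted by one). -/
def jacobiThetaPhi (t : ℝ) : ℝ := ∑' n : ℕ, jacobiThetaTerm (n + 1) t

/-- The kernel `K_n(t; φ) = ∫ φ(s + t) φ(s - t) s^{2n} ds` associated with `φ`,
the integral being over the whole real line. -/
def associatedKernel (n : ℕ) (φ : ℝ → ℝ) (t : ℝ) : ℝ :=
  ∫ s : ℝ, φ (s + t) * φ (s - t) * s ^ (2 * n)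

end

/-!
Write `y_n = π n² e^{4t}`. For a polynomial `P`, put `thetaSum P t = ∑ P(y_n) exp (-y_n)`. Such sums
are closed under differentiation, with `d/dt` acting on `P` (`hasDerivAt_thetaSum`), and
`Φ = e^t ∑ (2 y_n² - 3 y_n) exp (-y_n)`. Smoothness follows, as does the bound `O(exp (-t³))` for all
derivatives of `Φ`.

Evenness comes from Jacobi's functional equation: `H(t) = e^t θ(e^{4t})` is even and
`16 Φ = H'' - H`. It reduces positivity and concavity to `t ≥ 0`, where every `y_n ≥ 3`. There the
terms of `Φ` are positive, and `Φ Φ'' < (Φ')²` because the first term alone satisfies this inequality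
with a margin that exceeds the contribution of all others (`thetaSum_turan`). Hence `Φ'/Φ` is strictly
decreasing on the whole line; it vanishes at `0` by parity, so `Φ' < 0` on the positive half-line.

For `K_n`, the identity `max (|s + t|, |s - t|) = |s| + |t|` bounds the integrand and all its
derivatives in `t` by a multiple of `exp (-|t|³) exp (-|s|³) s^{2n}`, which justifies differentiation
under the integral sign and gives the decay. The `t`-derivative of `Φ(s + t) Φ(s - t)` has the sign of
`(Φ'/Φ)(s + t) - (Φ'/Φ)(s - t)`, negative for `t > 0` (`deriv_mul_sub_mul_deriv_neg`).
-/

open Real Polynomial MeasureTheory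

/-! ### Theta sums of polynomials -/

/-- The argument `y_n = π (n + 1)² e^{4t}` in which every term of the theta series is polynomial
times `exp (-y_n)`; the index is shifted so that `n = 0` is the leading term. -/
noncomputable def thetaArg (n : ℕ) (t : ℝ) : ℝ := π * ((n : ℝ) + 1) ^ 2 * exp (4 * t)

/-- The series `∑ P(y_n) exp (-y_n)` attached to a polynomial `P`, where `y_n = thetaArg n t`. -/
noncomputable def thetaSum (P : ℝ[X]) (t : ℝ) : ℝ := ∑' n : ℕ, P.eval (thetaArg n t) * exp (-thetaArg n t)

/-- The action of the Euler operator `y d/dy` on `P(y) exp (-y)`, written on the polynomial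
factor. -/
noncomputable def eulerOp (P : ℝ[X]) : ℝ[X] := X * (derivative P - P)

lemma thetaArg_pos (n : ℕ) (t : ℝ) : 0 < thetaArg n t := by
  unfold thetaArg; positivity

lemma hasDerivAt_thetaArg (n : ℕ) (t : ℝ) :
    HasDerivAt (thetaArg n) (4 * thetaArg n t) t := by
  have h := (((hasDerivAt_id t).const_mul 4).exp).const_mul (π * ((n : ℝ) + 1) ^ 2)
  refine h.congr_deriv ?_
  simp only [thetaArg, id]
  ring

lemma two_mul_le_thetaArg {a t : ℝ} (h : a ≤ t) (n : ℕ) :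
    2 * (((n : ℝ) + 1) * exp (4 * a)) ≤ thetaArg n t := by
  have h1 : exp (4 * a) ≤ exp (4 * t) := exp_le_exp.2 (by linarith)
  have h2 : (n : ℝ) + 1 ≤ ((n : ℝ) + 1) ^ 2 := by nlinarith [n.cast_nonneg (α := ℝ)]
  have h3 : 2 * ((n : ℝ) + 1) ≤ π * ((n : ℝ) + 1) ^ 2 := by nlinarith [pi_gt_three]
  unfold thetaArg
  calc 2 * (((n : ℝ) + 1) * exp (4 * a)) = 2 * ((n : ℝ) + 1) * exp (4 * a) := by ring
    _ ≤ _ := mul_le_mul h3 h1 (exp_pos _).le (by positivity)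

lemma exists_abs_eval_le_exp_half (P : ℝ[X]) :
    ∃ C : ℝ, 0 ≤ C ∧ ∀ y : ℝ, 0 ≤ y → |P.eval y| ≤ C * exp (y / 2) := by
  induction P using Polynomial.induction_on' with
  | add p q hp hq =>
    obtain ⟨C, hC, hp⟩ := hp
    obtain ⟨D, hD, hq⟩ := hq
    refine ⟨C + D, by positivity, fun y hy => ?_⟩
    rw [eval_add, add_mul]
    exact (abs_add_le _ _).trans (add_le_add (hp y hy) (hq y hy))
  | monomial n a =>
    refine ⟨|a| * (2 ^ n * n.factorial), by positivity, fun y hy => ?_⟩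
    have h := pow_div_factorial_le_exp (y / 2) (by positivity) n
    rw [div_le_iff₀ (by positivity), div_pow, div_le_iff₀ (by positivity)] at h
    rw [eval_monomial, abs_mul, abs_of_nonneg (pow_nonneg hy n), mul_assoc]
    refine mul_le_mul_of_nonneg_left (h.trans_eq (by ring)) (abs_nonneg a)

/-- Domination of the terms of a theta sum by a geometric sequence, uniformly on a half-line. -/
lemma exists_abs_term_le (P : ℝ[X]) :
    ∃ C : ℝ, 0 ≤ C ∧ ∀ a t : ℝ, a ≤ t → ∀ n : ℕ,
      |P.eval (thetaArg n t) * exp (-thetaArg n t)| ≤ C * exp (-exp (4 * a)) ^ (n + 1) := by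
  obtain ⟨C, hC, h⟩ := exists_abs_eval_le_exp_half P
  refine ⟨C, hC, fun a t hat n => ?_⟩
  have h1 := h _ (thetaArg_pos n t).le
  have h2 := two_mul_le_thetaArg hat n
  rw [abs_mul, abs_of_pos (exp_pos _), ← exp_nat_mul]
  calc |P.eval (thetaArg n t)| * exp (-thetaArg n t)
      ≤ C * exp (thetaArg n t / 2) * exp (-thetaArg n t) := by gcongr
    _ = C * exp (-(thetaArg n t / 2)) := by rw [mul_assoc, ← exp_add]; ring_nf
    _ ≤ _ := by gcongr; push_cast; linarith

lemma summable_geometric_bound (C a : ℝ) :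
    Summable fun n : ℕ => C * exp (-exp (4 * a)) ^ (n + 1) := by
  have h : exp (-exp (4 * a)) < 1 := by simp [exp_pos]
  exact (((summable_geometric_of_lt_one (exp_pos _).le h).comp_injective
    (add_left_injective 1))).mul_left C

lemma summable_thetaSum (P : ℝ[X]) (t : ℝ) :
    Summable fun n : ℕ => P.eval (thetaArg n t) * exp (-thetaArg n t) := by
  obtain ⟨C, -, h⟩ := exists_abs_term_le P
  exact Summable.of_norm_bounded (summable_geometric_bound C t) fun n => h t t le_rfl n

lemma thetaSum_add (P Q : ℝ[X]) (t : ℝ) : thetaSum (P + Q) t = thetaSum P t + thetaSum Q t := by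
  simp only [thetaSum, eval_add, add_mul]
  exact (summable_thetaSum P t).tsum_add (summable_thetaSum Q t)

lemma thetaSum_C_mul (c : ℝ) (P : ℝ[X]) (t : ℝ) : thetaSum (C c * P) t = c * thetaSum P t := by
  simp only [thetaSum, eval_mul, eval_C, mul_assoc]
  exact tsum_mul_left

lemma hasDerivAt_thetaSum (P : ℝ[X]) (t : ℝ) :
    HasDerivAt (thetaSum P) (4 * thetaSum (eulerOp P) t) t := by
  obtain ⟨K, -, h⟩ := exists_abs_term_le (C 4 * eulerOp P)
  have hd := hasDerivAt_tsum_of_isPreconnected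
    (g := fun n s => P.eval (thetaArg n s) * exp (-thetaArg n s))
    (g' := fun n s => (C 4 * eulerOp P).eval (thetaArg n s) * exp (-thetaArg n s))
    (summable_geometric_bound K (t - 1)) isOpen_Ioi (convex_Ioi (t - 1)).isPreconnected
    (fun n s _ => ?_) (fun n s hs => h _ _ (le_of_lt hs) n)
    (y₀ := t) (y := t) (by simp) (summable_thetaSum P t) (by simp)
  · exact hd.congr_deriv (thetaSum_C_mul 4 (eulerOp P) t)
  · have hy := hasDerivAt_thetaArg n s
    refine (((P.hasDerivAt _).comp s hy).mul hy.neg.exp).congr_deriv ?_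
    simp only [eulerOp, eval_mul, eval_C, eval_X, eval_sub, Function.comp, Pi.neg_apply]
    ring

/-- The action of `d/dt` on `e^t ∑ P(y_n) exp (-y_n)`, written on the polynomial. -/
noncomputable def twistedOp (P : ℝ[X]) : ℝ[X] := P + C 4 * eulerOp P

lemma hasDerivAt_exp_mul_thetaSum (P : ℝ[X]) (t : ℝ) :
    HasDerivAt (fun t => exp t * thetaSum P t) (exp t * thetaSum (twistedOp P) t) t := by
  refine ((Real.hasDerivAt_exp t).mul (hasDerivAt_thetaSum P t)).congr_deriv ?_
  rw [twistedOp, thetaSum_add, thetaSum_C_mul]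
  ring

lemma deriv_exp_mul_thetaSum (P : ℝ[X]) :
    deriv (fun t => exp t * thetaSum P t) = fun t => exp t * thetaSum (twistedOp P) t :=
  funext fun t => (hasDerivAt_exp_mul_thetaSum P t).deriv

lemma iteratedDeriv_exp_mul_thetaSum (k : ℕ) (P : ℝ[X]) :
    iteratedDeriv k (fun t => exp t * thetaSum P t) =
      fun t => exp t * thetaSum (twistedOp^[k] P) t := by
  induction k generalizing P with
  | zero => simp
  | succ k ih => rw [iteratedDeriv_succ', deriv_exp_mul_thetaSum, ih, Function.iterate_succ_apply]

lemma contDiff_exp_mul_thetaSum (P : ℝ[X]) : ContDiff ℝ ∞ fun t => exp t * thetaSum P t := by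
  refine contDiff_of_differentiable_iteratedDeriv fun m _ => ?_
  rw [iteratedDeriv_exp_mul_thetaSum]
  exact fun t => (hasDerivAt_exp_mul_thetaSum _ t).differentiableAt

lemma exists_abs_exp_mul_thetaSum_le (P : ℝ[X]) :
    ∃ C : ℝ, 0 ≤ C ∧ ∀ t : ℝ, 0 ≤ t → |exp t * thetaSum P t| ≤ C * exp (-t ^ 3) := by
  obtain ⟨C, hC, h⟩ := exists_abs_term_le P
  refine ⟨2 * C, by positivity, fun t ht => ?_⟩
  set r : ℝ := exp (-exp (4 * t)) with hr
  have hr0 : 0 < r := exp_pos _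
  have h1 : 1 ≤ exp (4 * t) := one_le_exp (by positivity)
  have hr1 : r ≤ 1 / 2 := by
    rw [hr, exp_neg, ← one_div]
    exact one_div_le_one_div_of_le two_pos (by linarith [add_one_le_exp (exp (4 * t))])
  have hs : HasSum (fun n : ℕ => C * r ^ (n + 1)) (C * (r * (1 - r)⁻¹)) := by
    simp only [pow_succ']
    exact ((hasSum_geometric_of_lt_one hr0.le (by linarith)).mul_left r).mul_left C
  have hb : |thetaSum P t| ≤ C * (r * (1 - r)⁻¹) :=
    tsum_of_norm_bounded (f := fun n => P.eval (thetaArg n t) * exp (-thetaArg n t)) hs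
      fun n => h t t le_rfl n
  have hi : (1 - r)⁻¹ ≤ 2 := by
    rw [inv_le_comm₀ (by linarith) two_pos]; linarith
  have hx : t + t ^ 3 ≤ exp (4 * t) := by
    have e1 : exp (4 * t) = exp t ^ 4 := by rw [← exp_nat_mul]; norm_num
    have e2 : (1 + t) ^ 4 ≤ exp t ^ 4 := by
      gcongr; linarith [add_one_le_exp t]
    nlinarith [pow_nonneg ht 2, pow_nonneg ht 3, pow_nonneg ht 4]
  rw [abs_mul, abs_of_pos (exp_pos _)]
  calc exp t * |thetaSum P t| ≤ exp t * (C * (r * 2)) := by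
        refine mul_le_mul_of_nonneg_left (hb.trans ?_) (exp_pos _).le
        gcongr
    _ = 2 * C * exp (t + -exp (4 * t)) := by rw [exp_add, ← hr]; ring
    _ ≤ 2 * C * exp (-t ^ 3) := by gcongr; linarith

/-! ### The function `Φ` as a theta sum; evenness -/

lemma jacobiThetaPhi_eq :
    jacobiThetaPhi = fun t => exp t * thetaSum (C 2 * X ^ 2 - C 3 * X) t := by
  funext t
  rw [jacobiThetaPhi, thetaSum, ← tsum_mul_left]
  refine tsum_congr fun n => ?_
  have h5 : exp (5 * t) = exp t * exp (4 * t) := by rw [← exp_add]; ring_nf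
  rw [jacobiThetaTerm, sub_eq_add_neg (5 * t), exp_add, h5]
  simp only [thetaArg, eval_sub, eval_mul, eval_C, eval_pow, eval_X]
  push_cast
  ring

/-- Jacobi's functional equation: `e^t θ(e^{4t})` is even, where `θ(x) = ∑ exp (-π n² x)` over the
integers. -/
lemma theta_even (t : ℝ) :
    exp t + 2 * (exp t * thetaSum 1 t) = exp (-t) + 2 * (exp (-t) * thetaSum 1 (-t)) := by
  have key : ∀ s : ℝ, ∑' n : ℤ, exp (-π * exp (4 * s) * (n : ℝ) ^ 2) = 1 + 2 * thetaSum 1 s := by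
    intro s
    have hsum := summable_thetaSum 1 s
    have h1 : (fun n : ℕ => exp (-π * exp (4 * s) * (((n : ℤ) + 1 : ℤ) : ℝ) ^ 2)) =
        fun n : ℕ => (1 : ℝ[X]).eval (thetaArg n s) * exp (-thetaArg n s) := by
      funext n
      rw [eval_one, one_mul, thetaArg]
      push_cast
      ring_nf
    have h2 : (fun n : ℕ => exp (-π * exp (4 * s) * ((-((n : ℤ) + 1) : ℤ) : ℝ) ^ 2)) =
        fun n : ℕ => (1 : ℝ[X]).eval (thetaArg n s) * exp (-thetaArg n s) := by
      rw [← h1]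
      funext n
      push_cast
      ring_nf
    rw [tsum_of_add_one_of_neg_add_one (f := fun n : ℤ => exp (-π * exp (4 * s) * (n : ℝ) ^ 2))
      (h1 ▸ hsum) (h2 ▸ hsum), h1, h2, thetaSum]
    simp
    ring
  have hP := Real.tsum_exp_neg_mul_int_sq (exp_pos (4 * t))
  have hinv : ∀ n : ℤ, -π / exp (4 * t) * (n : ℝ) ^ 2 = -π * exp (4 * -t) * (n : ℝ) ^ 2 := by
    intro n
    rw [mul_neg, exp_neg, div_eq_mul_inv]
  simp only [hinv] at hP
  rw [key, key, ← exp_mul, one_div, ← exp_neg] at hP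
  have hexp : exp t * exp (-(4 * t * (1 / 2))) = exp (-t) := by rw [← exp_add]; ring_nf
  linear_combination exp t * hP + (1 + 2 * thetaSum 1 (-t)) * hexp

/-- `16 Φ = H'' - H` for the even function `H(t) = e^t θ(e^{4t})`. -/
lemma jacobiThetaPhi_even (t : ℝ) : jacobiThetaPhi t = jacobiThetaPhi (-t) := by
  set H : ℝ → ℝ := fun t => exp t + 2 * (exp t * thetaSum 1 t) with hH
  have hd : ∀ s, deriv (deriv H) s = exp s + 2 * (exp s * thetaSum (twistedOp (twistedOp 1)) s) := by
    have h (P : ℝ[X]) : deriv (fun t => exp t + 2 * (exp t * thetaSum P t)) =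
        fun t => exp t + 2 * (exp t * thetaSum (twistedOp P) t) :=
      funext fun s => ((Real.hasDerivAt_exp s).add
        ((hasDerivAt_exp_mul_thetaSum P s).const_mul 2)).deriv
    intro s
    rw [hH, h, h]
  have hop : twistedOp (twistedOp 1) = 1 + C 8 * (C 2 * X ^ 2 - C 3 * X) := by
    simp only [twistedOp, eulerOp, derivative_add, derivative_sub, derivative_mul, derivative_X,
      derivative_one, derivative_zero, derivative_ofNat, map_ofNat]
    ring
  have hphi : ∀ s, deriv (deriv H) s - H s = 16 * jacobiThetaPhi s := by
    intro s
    rw [hd, hop, thetaSum_add, thetaSum_C_mul, hH, jacobiThetaPhi_eq]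
    ring
  have hev : (fun s => H (-s)) = H := funext fun s => (theta_even s).symm
  have h1 : ∀ s, deriv H s = -deriv H (-s) := fun s => by
    rw [← deriv_comp_neg, hev]
  have h2 : deriv (deriv H) t = deriv (deriv H) (-t) := by
    have : deriv H = fun s => -deriv H (-s) := funext h1
    conv_lhs => rw [this]
    rw [deriv.fun_neg, deriv_comp_neg, neg_neg]
  have h3 : H t = H (-t) := theta_even t
  linarith [hphi t, hphi (-t)]

/-! ### Positivity and logarithmic concavity of `Φ` -/

lemma three_le_thetaArg {t : ℝ} (ht : 0 ≤ t) (n : ℕ) : 3 ≤ thetaArg n t := by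
  have h1 : 1 ≤ exp (4 * t) := one_le_exp (by positivity)
  have h2 : (1 : ℝ) ≤ ((n : ℝ) + 1) ^ 2 := by nlinarith [n.cast_nonneg (α := ℝ)]
  unfold thetaArg
  nlinarith [pi_gt_three, mul_le_mul pi_gt_three.le h2 zero_le_one pi_pos.le]

lemma thetaSum_pos {P : ℝ[X]} {t : ℝ} (h : ∀ n, 0 < P.eval (thetaArg n t)) : 0 < thetaSum P t :=
  (summable_thetaSum P t).tsum_pos (fun n => (mul_pos (h n) (exp_pos _)).le) 0
    (mul_pos (h 0) (exp_pos _))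

lemma jacobiThetaPhi_pos (t : ℝ) : 0 < jacobiThetaPhi t := by
  wlog ht : 0 ≤ t generalizing t
  · rw [jacobiThetaPhi_even]
    exact this (-t) (by linarith)
  rw [jacobiThetaPhi_eq]
  refine mul_pos (exp_pos t) (thetaSum_pos fun n => ?_)
  have := three_le_thetaArg ht n
  simp only [eval_sub, eval_mul, eval_C, eval_pow, eval_X]
  nlinarith

/-- The terms after the first, with the eighth power of the index that the second Euler derivative
produces, are still geometrically small relative to the first. -/
lemma tail_term_le {y : ℝ} (hy : 3 ≤ y) (n : ℕ) :
    2 * ((n : ℝ) + 2) ^ 8 * y ^ 3 * exp (-(((n : ℝ) + 2) ^ 2 * y)) ≤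
      19 / 10 * (1 / 100) ^ n * exp (-y) := by
  have hn : (0 : ℝ) ≤ n := n.cast_nonneg
  have e1 : y ^ 3 ≤ 27 * exp (y - 3) := by
    have h := add_one_le_exp (y / 3 - 1)
    have h2 : (y / 3) ^ 3 ≤ exp (y / 3 - 1) ^ 3 := by gcongr; linarith
    have h3 : exp (y / 3 - 1) ^ 3 = exp (y - 3) := by rw [← exp_nat_mul]; ring_nf
    rw [h3] at h2
    linarith [show (y / 3) ^ 3 = y ^ 3 / 27 by ring]
  have e2 : ((n : ℝ) + 2) ^ 8 ≤ 256 * exp (4 * n) := by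
    have h := add_one_le_exp ((n : ℝ) / 2)
    have h2 : ((n : ℝ) / 2 + 1) ^ 8 ≤ exp ((n : ℝ) / 2) ^ 8 := by gcongr
    have h3 : exp ((n : ℝ) / 2) ^ 8 = exp (4 * n) := by rw [← exp_nat_mul]; ring_nf
    rw [h3] at h2
    linarith [show ((n : ℝ) / 2 + 1) ^ 8 = ((n : ℝ) + 2) ^ 8 / 256 by ring]
  have e3 : -(((n : ℝ) + 2) ^ 2 * y) ≤ -y - y - 6 - 12 * n := by
    nlinarith [mul_nonneg (by nlinarith : (0 : ℝ) ≤ (n + 2) ^ 2 - 2) (sub_nonneg.2 hy),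
      sq_nonneg (n : ℝ)]
  have he : (2.7 : ℝ) < exp 1 := by linarith [exp_one_gt_d9]
  have e4 : exp (-9 : ℝ) ≤ 1 / 7625 := by
    have h : (2.7 : ℝ) ^ 9 ≤ exp 1 ^ 9 := by gcongr
    rw [← exp_nat_mul] at h
    rw [exp_neg, ← one_div]
    refine one_div_le_one_div_of_le (by norm_num) ?_
    norm_num at h ⊢
    linarith
  have e5 : exp (-8 * (n : ℝ)) ≤ (1 / 100) ^ n := by
    rw [mul_comm, exp_nat_mul]
    gcongr
    have h : (2.7 : ℝ) ^ 8 ≤ exp 1 ^ 8 := by gcongr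
    rw [← exp_nat_mul] at h
    rw [exp_neg, ← one_div]
    refine one_div_le_one_div_of_le (by norm_num) ?_
    norm_num at h ⊢
    linarith
  calc 2 * ((n : ℝ) + 2) ^ 8 * y ^ 3 * exp (-(((n : ℝ) + 2) ^ 2 * y))
      ≤ 2 * (256 * exp (4 * n)) * (27 * exp (y - 3)) * exp (-y - y - 6 - 12 * n) := by gcongr
    _ = 13824 * exp (-9) * exp (-8 * (n : ℝ)) * exp (-y) := by
        rw [show 2 * (256 * exp (4 * (n : ℝ))) * (27 * exp (y - 3)) * exp (-y - y - 6 - 12 * n) =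
          13824 * (exp (4 * (n : ℝ)) * exp (y - 3) * exp (-y - y - 6 - 12 * n)) by ring,
          mul_assoc, mul_assoc, ← exp_add, ← exp_add, mul_assoc, ← exp_add, ← exp_add]
        ring_nf
    _ ≤ 13824 * (1 / 7625) * (1 / 100) ^ n * exp (-y) := by gcongr
    _ ≤ _ := by gcongr; norm_num

/-- Separation of the first term of a theta sum from a remainder controlled by `tail_term_le`. -/
lemma thetaSum_le_first_add {P : ℝ[X]} {t c : ℝ} (ht : 0 ≤ t) (hc : 0 ≤ c)
    (h : ∀ n : ℕ, P.eval (thetaArg (n + 1) t) ≤ c * (2 * ((n : ℝ) + 2) ^ 8 * thetaArg 0 t ^ 3)) :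
    thetaSum P t ≤
      P.eval (thetaArg 0 t) * exp (-thetaArg 0 t) + 2 * c * exp (-thetaArg 0 t) := by
  set y := thetaArg 0 t with hy
  have hy3 : 3 ≤ y := three_le_thetaArg ht 0
  have harg (n : ℕ) : thetaArg (n + 1) t = ((n : ℝ) + 2) ^ 2 * y := by
    simp only [hy, thetaArg]; push_cast; ring
  have hsum := summable_thetaSum P t
  rw [thetaSum, hsum.tsum_eq_zero_add]
  refine add_le_add_right ?_ _
  have hg : HasSum (fun n : ℕ => c * (19 / 10 * (1 / 100) ^ n * exp (-y)))
      (c * (19 / 10 * (1 - 1 / 100)⁻¹ * exp (-y))) :=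
    (((hasSum_geometric_of_lt_one (by norm_num) (by norm_num)).mul_left _).mul_right _).mul_left c
  calc ∑' n : ℕ, P.eval (thetaArg (n + 1) t) * exp (-thetaArg (n + 1) t)
      ≤ ∑' n : ℕ, c * (19 / 10 * (1 / 100) ^ n * exp (-y)) := by
        refine Summable.tsum_le_tsum (fun n => ?_) ((summable_nat_add_iff 1).2 hsum) hg.summable
        refine (mul_le_mul_of_nonneg_right (h n) (exp_pos _).le).trans ?_
        rw [mul_assoc, harg]
        exact mul_le_mul_of_nonneg_left (tail_term_le hy3 n) hc
    _ = c * (19 / 10 * (1 - 1 / 100)⁻¹ * exp (-y)) := hg.tsum_eq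
    _ ≤ 2 * c * exp (-y) := by nlinarith [mul_nonneg hc (exp_pos (-y)).le]

/-- The Turán-type inequality `f δ²f < (δf)²` for `f = ∑ (2 y_n² - 3 y_n) exp (-y_n)` and the Euler
derivation `δ`. For the first term alone the difference is `y³ ((2y - 3)² + 6) exp (-2y)`, at least
`15 y³ exp (-2y)` since `y ≥ 3`, and the other terms take away at most `8 y³ exp (-2y)`. -/
lemma thetaSum_turan {t : ℝ} (ht : 0 ≤ t) {P : ℝ[X]} (hP : P = C 2 * X ^ 2 - C 3 * X) :
    thetaSum P t * thetaSum (eulerOp (eulerOp P)) t < thetaSum (eulerOp P) t ^ 2 := by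
  have ev0 (z : ℝ) : P.eval z = 2 * z ^ 2 - 3 * z := by simp [hP]
  have ev1 (z : ℝ) : (eulerOp P).eval z = -2 * z ^ 3 + 7 * z ^ 2 - 3 * z := by
    simp [hP, eulerOp]; ring
  have ev2 (z : ℝ) : (eulerOp (eulerOp P)).eval z =
      2 * z ^ 4 - 13 * z ^ 3 + 17 * z ^ 2 - 3 * z := by
    simp [hP, eulerOp]; ring
  set y := thetaArg 0 t with hy
  have hy3 : 3 ≤ y := three_le_thetaArg ht 0
  have harg (n : ℕ) : thetaArg (n + 1) t = ((n : ℝ) + 2) ^ 2 * y := by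
    simp only [hy, thetaArg]; push_cast; ring
  set E := exp (-y) with hE
  have hE0 : 0 < E := exp_pos _
  have hfirst_le : ∀ Q : ℝ[X], (∀ n : ℕ, 0 ≤ Q.eval (thetaArg (n + 1) t)) →
      Q.eval y * E ≤ thetaSum Q t := fun Q hQ => by
    have hsum := summable_thetaSum Q t
    rw [thetaSum, hsum.tsum_eq_zero_add]
    exact le_add_of_nonneg_right (tsum_nonneg fun n => mul_nonneg (hQ n) (exp_pos _).le)
  have lo0 : (2 * y ^ 2 - 3 * y) * E ≤ thetaSum P t := by
    rw [← ev0]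
    refine hfirst_le P fun n => ?_
    rw [ev0]
    nlinarith [three_le_thetaArg ht (n + 1)]
  have hi0 : thetaSum P t ≤ (2 * y ^ 2 - 3 * y) * E + 2 * y⁻¹ * E := by
    rw [← ev0]
    refine thetaSum_le_first_add ht (by positivity) fun n => ?_
    have hyne : y ≠ 0 := by positivity
    have h48 : ((n : ℝ) + 2) ^ 4 ≤ ((n : ℝ) + 2) ^ 8 :=
      pow_le_pow_right₀ (by linarith [n.cast_nonneg (α := ℝ)]) (by norm_num)
    rw [ev0]
    calc _ ≤ 2 * thetaArg (n + 1) t ^ 2 := by linarith [thetaArg_pos (n + 1) t]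
      _ = 2 * ((n : ℝ) + 2) ^ 4 * y ^ 2 := by rw [harg]; ring
      _ ≤ 2 * ((n : ℝ) + 2) ^ 8 * y ^ 2 := by gcongr
      _ = _ := by rw [← hy]; field_simp
  have hi1 : thetaSum (eulerOp P) t ≤ (-2 * y ^ 3 + 7 * y ^ 2 - 3 * y) * E := by
    have h := thetaSum_le_first_add (P := eulerOp P) (c := 0) ht le_rfl fun n => by
      have h3 := three_le_thetaArg ht (n + 1)
      rw [ev1, zero_mul]
      nlinarith [mul_nonneg (by linarith : 0 ≤ thetaArg (n + 1) t - 3)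
        (by positivity : 0 ≤ thetaArg (n + 1) t ^ 2), mul_nonneg
        (by linarith : 0 ≤ thetaArg (n + 1) t - 3) (by linarith : 0 ≤ thetaArg (n + 1) t)]
    rw [ev1] at h
    linarith
  have hi2 : thetaSum (eulerOp (eulerOp P)) t ≤
      (2 * y ^ 4 - 13 * y ^ 3 + 17 * y ^ 2 - 3 * y) * E + 2 * y * E := by
    rw [← ev2]
    refine thetaSum_le_first_add ht (by positivity) fun n => ?_
    rw [ev2]
    have h3 := three_le_thetaArg ht (n + 1)
    calc _ ≤ 2 * thetaArg (n + 1) t ^ 4 := by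
          nlinarith [mul_nonneg (by linarith : 0 ≤ thetaArg (n + 1) t - 3)
            (by positivity : 0 ≤ thetaArg (n + 1) t ^ 2)]
      _ = _ := by rw [harg]; ring
  set S₀ := thetaSum P t
  set S₁ := thetaSum (eulerOp P) t
  set S₂ := thetaSum (eulerOp (eulerOp P)) t
  -- `2y³ - 7y² + 3y = y (2y - 1) (y - 3)` is nonnegative, so squaring the bound on `S₁` is allowed.
  have hsq : ((2 * y ^ 3 - 7 * y ^ 2 + 3 * y) * E) ^ 2 ≤ S₁ ^ 2 := by
    have h0 : 0 ≤ (2 * y ^ 3 - 7 * y ^ 2 + 3 * y) * E := by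
      have : 0 ≤ y * ((2 * y - 1) * (y - 3)) :=
        mul_nonneg (by linarith) (mul_nonneg (by linarith) (by linarith))
      exact mul_nonneg (by linarith) hE0.le
    rw [← neg_sq S₁]
    exact pow_le_pow_left₀ h0 (by linarith) 2
  have hS0 : 0 ≤ S₀ := le_trans (mul_nonneg (by nlinarith) hE0.le) lo0
  -- The remainder in `S₀` multiplies a quantity of unknown sign, which is first raised to `2y⁴`.
  have hprod : S₀ * S₂ ≤
      ((2 * y ^ 2 - 3 * y) * (2 * y ^ 4 - 13 * y ^ 3 + 17 * y ^ 2 - 3 * y) + 8 * y ^ 3) * E ^ 2 := by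
    have hy2 : 0 ≤ y ^ 2 * (y - 3) := mul_nonneg (by positivity) (by linarith)
    have hd : 2 * y ^ 4 - 13 * y ^ 3 + 17 * y ^ 2 - 3 * y + 2 * y ≤ 2 * y ^ 4 := by
      nlinarith [pow_nonneg (by linarith : 0 ≤ y) 2]
    have a1 : S₀ * S₂ ≤ S₀ * ((2 * y ^ 4 - 13 * y ^ 3 + 17 * y ^ 2 - 3 * y + 2 * y) * E) :=
      mul_le_mul_of_nonneg_left (by linarith) hS0
    have a2 : (S₀ - (2 * y ^ 2 - 3 * y) * E) *
        ((2 * y ^ 4 - 13 * y ^ 3 + 17 * y ^ 2 - 3 * y + 2 * y) * E) ≤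
        (2 * y⁻¹ * E) * (2 * y ^ 4 * E) :=
      (mul_le_mul_of_nonneg_left (mul_le_mul_of_nonneg_right hd hE0.le) (by linarith)).trans
        (mul_le_mul_of_nonneg_right (by linarith) (by positivity))
    have a3 : (2 * y⁻¹ * E) * (2 * y ^ 4 * E) = 4 * y ^ 3 * E ^ 2 := by
      field_simp
      ring
    nlinarith [mul_nonneg (by positivity : 0 ≤ y ^ 2) (sq_nonneg E)]
  refine hprod.trans_lt (lt_of_lt_of_le ?_ hsq)
  rw [mul_pow]
  refine mul_lt_mul_of_pos_right ?_ (by positivity)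
  have hpos : 0 < y ^ 3 * ((2 * y - 3) ^ 2 - 2) := mul_pos (by positivity) (by nlinarith)
  linarith [show (2 * y ^ 3 - 7 * y ^ 2 + 3 * y) ^ 2 -
    ((2 * y ^ 2 - 3 * y) * (2 * y ^ 4 - 13 * y ^ 3 + 17 * y ^ 2 - 3 * y) + 8 * y ^ 3) =
    y ^ 3 * ((2 * y - 3) ^ 2 - 2) by ring]

lemma contDiff_jacobiThetaPhi : ContDiff ℝ ∞ jacobiThetaPhi :=
  jacobiThetaPhi_eq ▸ contDiff_exp_mul_thetaSum _

lemma jacobiThetaPhi_comp_neg : (fun t => jacobiThetaPhi (-t)) = jacobiThetaPhi :=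
  funext fun t => (jacobiThetaPhi_even t).symm

lemma deriv_jacobiThetaPhi_odd (t : ℝ) :
    deriv jacobiThetaPhi (-t) = -deriv jacobiThetaPhi t := by
  conv_rhs => rw [← jacobiThetaPhi_comp_neg, deriv_comp_neg, neg_neg]

lemma jacobiThetaPhi_turan (t : ℝ) :
    jacobiThetaPhi t * deriv (deriv jacobiThetaPhi) t < deriv jacobiThetaPhi t ^ 2 := by
  wlog ht : 0 ≤ t generalizing t
  · have h := this (-t) (by linarith)
    have h2 : deriv (deriv jacobiThetaPhi) (-t) = deriv (deriv jacobiThetaPhi) t := by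
      have h1 : deriv jacobiThetaPhi = fun s => -deriv jacobiThetaPhi (-s) :=
        funext fun s => by rw [deriv_jacobiThetaPhi_odd, neg_neg]
      conv_rhs => rw [h1]
      rw [deriv.fun_neg, deriv_comp_neg, neg_neg]
    rwa [← jacobiThetaPhi_even, h2, deriv_jacobiThetaPhi_odd, neg_sq] at h
  rw [jacobiThetaPhi_eq, deriv_exp_mul_thetaSum, deriv_exp_mul_thetaSum]
  have h := thetaSum_turan ht rfl
  set P : ℝ[X] := C 2 * X ^ 2 - C 3 * X
  have h1 : twistedOp (twistedOp P) = P + C 8 * eulerOp P + C 16 * eulerOp (eulerOp P) := by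
    simp only [twistedOp, eulerOp, derivative_add, derivative_sub, derivative_mul, derivative_X,
      derivative_ofNat, map_ofNat]
    ring
  rw [h1]
  simp only [twistedOp, thetaSum_add, thetaSum_C_mul]
  nlinarith [mul_pos (pow_pos (exp_pos t) 2) (sub_pos.2 h)]

lemma hasDerivAt_logDeriv_jacobiThetaPhi (t : ℝ) :
    HasDerivAt (fun s => deriv jacobiThetaPhi s / jacobiThetaPhi s)
      ((deriv (deriv jacobiThetaPhi) t * jacobiThetaPhi t -
        deriv jacobiThetaPhi t * deriv jacobiThetaPhi t) / jacobiThetaPhi t ^ 2) t := by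
  have h0 := (contDiff_infty_iff_deriv.1 contDiff_jacobiThetaPhi)
  have h1 := (contDiff_infty_iff_deriv.1 h0.2).1 t
  exact h1.hasDerivAt.div (h0.1 t).hasDerivAt (jacobiThetaPhi_pos t).ne'

lemma deriv_logDeriv_jacobiThetaPhi_neg (t : ℝ) :
    deriv (fun s => deriv jacobiThetaPhi s / jacobiThetaPhi s) t < 0 := by
  rw [(hasDerivAt_logDeriv_jacobiThetaPhi t).deriv]
  refine div_neg_of_neg_of_pos ?_ (pow_pos (jacobiThetaPhi_pos t) 2)
  linarith [jacobiThetaPhi_turan t]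

lemma strictAnti_logDeriv_jacobiThetaPhi :
    StrictAnti fun s => deriv jacobiThetaPhi s / jacobiThetaPhi s :=
  strictAnti_of_deriv_neg deriv_logDeriv_jacobiThetaPhi_neg

lemma isStrictlyLogConcaveKernel_jacobiThetaPhi :
    IsStrictlyLogConcaveKernel jacobiThetaPhi := by
  intro t _
  have h : deriv (fun u => log (jacobiThetaPhi u)) =
      fun s => deriv jacobiThetaPhi s / jacobiThetaPhi s :=
    funext fun s => deriv.log ((contDiff_infty_iff_deriv.1 contDiff_jacobiThetaPhi).1 s)
      (jacobiThetaPhi_pos s).ne'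
  rw [iteratedDeriv_succ, iteratedDeriv_one, h]
  exact deriv_logDeriv_jacobiThetaPhi_neg t

lemma deriv_jacobiThetaPhi_neg {t : ℝ} (ht : 0 < t) : deriv jacobiThetaPhi t < 0 := by
  have h0 : deriv jacobiThetaPhi 0 = 0 := by
    have := deriv_jacobiThetaPhi_odd 0
    rw [neg_zero] at this
    linarith
  have h : deriv jacobiThetaPhi t / jacobiThetaPhi t < deriv jacobiThetaPhi 0 / jacobiThetaPhi 0 :=
    strictAnti_logDeriv_jacobiThetaPhi ht
  rw [h0, zero_div, div_lt_iff₀ (jacobiThetaPhi_pos t), zero_mul] at h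
  exact h

/-! ### Cubic exponential decay and correlation integrals -/

/-- Smooth functions on the line all of whose derivatives are `O(exp (-|t|³))`, on both sides. -/
structure HasCubicDecay (f : ℝ → ℝ) : Prop where
  contDiff : ContDiff ℝ ∞ f
  bound : ∀ k : ℕ, ∃ C : ℝ, ∀ t : ℝ, |iteratedDeriv k f t| ≤ C * exp (-|t| ^ 3)

/-- The bilinear form behind `associatedKernel`; it separates the two factors so that it is stable
under differentiation. -/
noncomputable def correlation (n : ℕ) (f g : ℝ → ℝ) (t : ℝ) : ℝ :=
  ∫ s : ℝ, f (s + t) * g (s - t) * s ^ (2 * n)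

namespace HasCubicDecay

variable {f g : ℝ → ℝ}

lemma exists_bound (hf : HasCubicDecay f) :
    ∃ C : ℝ, 0 ≤ C ∧ ∀ t : ℝ, |f t| ≤ C * exp (-|t| ^ 3) := by
  obtain ⟨C, hC⟩ := hf.bound 0
  simp only [iteratedDeriv_zero] at hC
  exact ⟨C, nonneg_of_mul_nonneg_left ((abs_nonneg _).trans (hC 0)) (exp_pos _), hC⟩

lemma deriv (hf : HasCubicDecay f) : HasCubicDecay (deriv f) where
  contDiff := (contDiff_infty_iff_deriv.1 hf.contDiff).2
  bound k := by simpa only [iteratedDeriv_succ'] using hf.bound (k + 1)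

lemma hasDerivAt (hf : HasCubicDecay f) (t : ℝ) : HasDerivAt f (_root_.deriv f t) t :=
  ((contDiff_infty_iff_deriv.1 hf.contDiff).1 t).hasDerivAt

lemma isBigO (hf : HasCubicDecay f) (k : ℕ) :
    iteratedDeriv k f =O[Filter.atTop] fun t : ℝ => exp (-|t| ^ ((2 : ℝ) + 1)) := by
  obtain ⟨C, hC⟩ := hf.bound k
  refine Asymptotics.IsBigO.of_bound C (Filter.Eventually.of_forall fun t => ?_)
  rw [norm_of_nonneg (exp_pos _).le, show (2 : ℝ) + 1 = (3 : ℕ) by norm_num, rpow_natCast]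
  exact hC t

end HasCubicDecay

lemma exp_cube_mul_exp_cube_le (s t : ℝ) :
    exp (-|s + t| ^ 3) * exp (-|s - t| ^ 3) ≤ exp (-|s| ^ 3) * exp (-|t| ^ 3) := by
  rw [← exp_add, ← exp_add, exp_le_exp]
  have h1 : |s| ^ 3 + |t| ^ 3 ≤ (|s| + |t|) ^ 3 := by
    have : 0 ≤ |s| * |t| * (|s| + |t|) := by positivity
    linarith [show (|s| + |t|) ^ 3 = |s| ^ 3 + |t| ^ 3 + 3 * (|s| * |t| * (|s| + |t|)) by ring]
  have h2 : |s| + |t| ≤ |s + t| ∨ |s| + |t| ≤ |s - t| := by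
    rcases abs_cases s with ⟨hs, -⟩ | ⟨hs, -⟩ <;> rcases abs_cases t with ⟨ht, -⟩ | ⟨ht, -⟩ <;>
      rw [hs, ht]
    · exact .inl (le_abs_self _)
    · exact .inr ((le_abs_self _).trans' (by linarith))
    · exact .inr ((neg_le_abs _).trans' (by linarith))
    · exact .inl ((neg_le_abs _).trans' (by linarith))
  have h3 : 0 ≤ |s + t| ^ 3 := by positivity
  have h4 : 0 ≤ |s - t| ^ 3 := by positivity
  rcases h2 with h | h
  · linarith [pow_le_pow_left₀ (by positivity) h 3]
  · linarith [pow_le_pow_left₀ (by positivity) h 3]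

lemma integrable_exp_cube_mul_pow (n : ℕ) :
    Integrable fun s : ℝ => exp (-|s| ^ 3) * s ^ (2 * n) := by
  have h := (integrable_rpow_mul_exp_neg_mul_sq one_pos
    (s := ((2 * n : ℕ) : ℝ)) (by linarith [(2 * n : ℕ).cast_nonneg (α := ℝ)])).const_mul (exp 1)
  refine h.mono' (by fun_prop) (Filter.Eventually.of_forall fun s => ?_)
  have h0 : 0 ≤ s ^ (2 * n) := (even_two_mul n).pow_nonneg s
  have h1 : exp (-|s| ^ 3) ≤ exp 1 * exp (-1 * s ^ 2) := by
    rw [← exp_add, exp_le_exp, ← sq_abs]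
    have := abs_nonneg s
    nlinarith [mul_nonneg (by linarith : 0 ≤ |s| + 1) (sq_nonneg (|s| - 1))]
  rw [norm_of_nonneg (mul_nonneg (exp_pos _).le h0), rpow_natCast]
  calc _ ≤ exp 1 * exp (-1 * s ^ 2) * s ^ (2 * n) := by gcongr
    _ = _ := by ring

section Correlation

variable {f g : ℝ → ℝ}

lemma exists_abs_integrand_le (n : ℕ) (hf : HasCubicDecay f) (hg : HasCubicDecay g) :
    ∃ C : ℝ, 0 ≤ C ∧ ∀ s t : ℝ, |f (s + t) * g (s - t) * s ^ (2 * n)| ≤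
      C * exp (-|t| ^ 3) * (exp (-|s| ^ 3) * s ^ (2 * n)) := by
  obtain ⟨C, hC, hf⟩ := hf.exists_bound
  obtain ⟨D, hD, hg⟩ := hg.exists_bound
  refine ⟨C * D, by positivity, fun s t => ?_⟩
  have h0 : 0 ≤ s ^ (2 * n) := (even_two_mul n).pow_nonneg s
  rw [abs_mul, abs_mul, abs_of_nonneg h0]
  calc _ ≤ C * exp (-|s + t| ^ 3) * (D * exp (-|s - t| ^ 3)) * s ^ (2 * n) := by
        gcongr
        · exact hf _
        · exact hg _
    _ = C * D * (exp (-|s + t| ^ 3) * exp (-|s - t| ^ 3)) * s ^ (2 * n) := by ring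
    _ ≤ C * D * (exp (-|s| ^ 3) * exp (-|t| ^ 3)) * s ^ (2 * n) := by
        gcongr C * D * ?_ * s ^ (2 * n)
        exact exp_cube_mul_exp_cube_le s t
    _ = _ := by ring

lemma continuous_integrand (n : ℕ) (hf : HasCubicDecay f) (hg : HasCubicDecay g) (t : ℝ) :
    Continuous fun s : ℝ => f (s + t) * g (s - t) * s ^ (2 * n) := by
  have h1 := hf.contDiff.continuous
  have h2 := hg.contDiff.continuous
  fun_prop

lemma integrable_integrand (n : ℕ) (hf : HasCubicDecay f) (hg : HasCubicDecay g) (t : ℝ) :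
    Integrable fun s : ℝ => f (s + t) * g (s - t) * s ^ (2 * n) := by
  obtain ⟨C, -, h⟩ := exists_abs_integrand_le n hf hg
  exact ((integrable_exp_cube_mul_pow n).const_mul _).mono'
    (continuous_integrand n hf hg t).aestronglyMeasurable
    (Filter.Eventually.of_forall fun s => h s t)

lemma exists_abs_correlation_le (n : ℕ) (hf : HasCubicDecay f) (hg : HasCubicDecay g) :
    ∃ C : ℝ, ∀ t : ℝ, |correlation n f g t| ≤ C * exp (-|t| ^ 3) := by
  obtain ⟨C, -, h⟩ := exists_abs_integrand_le n hf hg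
  refine ⟨C * ∫ s : ℝ, exp (-|s| ^ 3) * s ^ (2 * n), fun t => ?_⟩
  have := norm_integral_le_of_norm_le (f := fun s => f (s + t) * g (s - t) * s ^ (2 * n))
    ((integrable_exp_cube_mul_pow n).const_mul (C * exp (-|t| ^ 3)))
    (Filter.Eventually.of_forall fun s => h s t)
  rw [integral_const_mul] at this
  exact this.trans_eq (by ring)

lemma hasDerivAt_correlation (n : ℕ) (hf : HasCubicDecay f) (hg : HasCubicDecay g) (t : ℝ) :
    HasDerivAt (correlation n f g)
      (correlation n (deriv f) g t - correlation n f (deriv g) t) t := by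
  obtain ⟨C, hC, h1⟩ := exists_abs_integrand_le n hf.deriv hg
  obtain ⟨D, hD, h2⟩ := exists_abs_integrand_le n hf hg.deriv
  rw [correlation, correlation, ← integral_sub (integrable_integrand n hf.deriv hg t)
    (integrable_integrand n hf hg.deriv t)]
  refine (hasDerivAt_integral_of_dominated_loc_of_deriv_le
    (F := fun t s => f (s + t) * g (s - t) * s ^ (2 * n))
    (F' := fun t s => deriv f (s + t) * g (s - t) * s ^ (2 * n) -
      f (s + t) * deriv g (s - t) * s ^ (2 * n))
    (bound := fun s => (C + D) * (exp (-|s| ^ 3) * s ^ (2 * n)))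
    Filter.univ_mem
    (Filter.Eventually.of_forall fun t => (continuous_integrand n hf hg t).aestronglyMeasurable)
    (integrable_integrand n hf hg t)
    ((integrable_integrand n hf.deriv hg t).sub
      (integrable_integrand n hf hg.deriv t)).aestronglyMeasurable
    (Filter.Eventually.of_forall fun s u _ => ?_)
    ((integrable_exp_cube_mul_pow n).const_mul _)
    (Filter.Eventually.of_forall fun s u _ => ?_)).2
  · have h0 : 0 ≤ exp (-|s| ^ 3) * s ^ (2 * n) :=
      mul_nonneg (exp_pos _).le ((even_two_mul n).pow_nonneg s)
    have he : exp (-|u| ^ 3) ≤ 1 := exp_le_one_iff.2 (by simp)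
    refine (norm_sub_le _ _).trans ((add_le_add (h1 s u) (h2 s u)).trans ?_)
    rw [← add_mul, ← add_mul]
    exact mul_le_mul_of_nonneg_right (mul_le_of_le_one_right (by positivity) he) h0
  · have e1 : HasDerivAt (fun u => f (s + u)) (deriv f (s + u)) u :=
      (hf.hasDerivAt (s + u)).comp_const_add s u
    have e2 : HasDerivAt (fun u => g (s - u)) (-deriv g (s - u)) u :=
      (hg.hasDerivAt (s - u)).comp_const_sub s u
    refine ((e1.mul e2).mul_const (s ^ (2 * n))).congr_deriv ?_
    ring

lemma deriv_correlation (n : ℕ) (hf : HasCubicDecay f) (hg : HasCubicDecay g) :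
    deriv (correlation n f g) = correlation n (deriv f) g - correlation n f (deriv g) :=
  funext fun t => (hasDerivAt_correlation n hf hg t).deriv

lemma contDiff_correlation (n : ℕ) (hf : HasCubicDecay f) (hg : HasCubicDecay g) :
    ContDiff ℝ ∞ (correlation n f g) := by
  refine contDiff_infty.2 fun k => ?_
  induction k generalizing f g with
  | zero =>
    exact contDiff_zero.2 (continuous_iff_continuousAt.2 fun t =>
      (hasDerivAt_correlation n hf hg t).continuousAt)
  | succ k ih =>
    rw [Nat.cast_succ, contDiff_succ_iff_deriv]
    refine ⟨fun t => (hasDerivAt_correlation n hf hg t).differentiableAt, by simp, ?_⟩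
    rw [deriv_correlation n hf hg]
    exact (ih hf.deriv hg).sub (ih hf hg.deriv)

lemma HasCubicDecay.correlation (n : ℕ) (hf : HasCubicDecay f) (hg : HasCubicDecay g) :
    HasCubicDecay (correlation n f g) where
  contDiff := contDiff_correlation n hf hg
  bound k := by
    induction k generalizing f g with
    | zero => simpa using exists_abs_correlation_le n hf hg
    | succ k ih =>
      obtain ⟨C, hC⟩ := ih hf.deriv hg
      obtain ⟨D, hD⟩ := ih hf hg.deriv
      refine ⟨C + D, fun t => ?_⟩
      have hk : (k : WithTop ℕ∞) ≤ ∞ := by exact_mod_cast le_top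
      rw [iteratedDeriv_succ', deriv_correlation n hf hg,
        iteratedDeriv_sub ((contDiff_correlation n hf.deriv hg).of_le hk).contDiffAt
          ((contDiff_correlation n hf hg.deriv).of_le hk).contDiffAt, add_mul]
      exact (abs_sub _ _).trans (add_le_add (hC t) (hD t))

end Correlation

/-- A continuous integrable function that is nonnegative and positive off the origin has positive
integral. -/
lemma integral_pos_of_pos_off_zero {F : ℝ → ℝ} (hF : Integrable F) (h0 : ∀ s, 0 ≤ F s)
    (hpos : ∀ s, s ≠ 0 → 0 < F s) : 0 < ∫ s, F s := by
  rw [integral_pos_iff_support_of_nonneg h0 hF]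
  refine lt_of_lt_of_le ?_ (measure_mono (s := Set.Ioo 0 1) fun s hs => (hpos s hs.1.ne').ne')
  simp

/-! ### The kernels `Φ` and `K_n` -/

lemma hasCubicDecay_jacobiThetaPhi : HasCubicDecay jacobiThetaPhi where
  contDiff := contDiff_jacobiThetaPhi
  bound k := by
    obtain ⟨C, -, h⟩ := exists_abs_exp_mul_thetaSum_le (twistedOp^[k] (C 2 * X ^ 2 - C 3 * X))
    have hk : ∀ t, 0 ≤ t → |iteratedDeriv k jacobiThetaPhi t| ≤ C * exp (-t ^ 3) := by
      rw [jacobiThetaPhi_eq, iteratedDeriv_exp_mul_thetaSum]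
      exact h
    have hpar (t : ℝ) : |iteratedDeriv k jacobiThetaPhi t| =
        |iteratedDeriv k jacobiThetaPhi (-t)| := by
      have := iteratedDeriv_comp_neg k jacobiThetaPhi t
      rw [jacobiThetaPhi_comp_neg] at this
      rw [this, smul_eq_mul, abs_mul, abs_neg_one_pow, one_mul]
    refine ⟨C, fun t => ?_⟩
    rcases abs_choice t with ht | ht
    · rw [ht]
      exact hk t (ht ▸ abs_nonneg t)
    · rw [hpar, ht]
      exact hk (-t) (ht ▸ abs_nonneg t)

lemma isAdmissibleKernel_jacobiThetaPhi : IsAdmissibleKernel jacobiThetaPhi where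
  smooth := contDiff_jacobiThetaPhi
  pos := jacobiThetaPhi_pos
  even := jacobiThetaPhi_even
  deriv_neg _ := deriv_jacobiThetaPhi_neg
  decay := ⟨1, one_pos, hasCubicDecay_jacobiThetaPhi.isBigO⟩

/-- The derivative of `Φ(s + t) Φ(s - t)` in `t` is the product times
`(log Φ)'(s + t) - (log Φ)'(s - t)`, which is negative for `t > 0` by logarithmic concavity on the
whole line. -/
lemma deriv_mul_sub_mul_deriv_neg (s : ℝ) {t : ℝ} (ht : 0 < t) :
    deriv jacobiThetaPhi (s + t) * jacobiThetaPhi (s - t) -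
      jacobiThetaPhi (s + t) * deriv jacobiThetaPhi (s - t) < 0 := by
  have h : deriv jacobiThetaPhi (s + t) / jacobiThetaPhi (s + t) <
      deriv jacobiThetaPhi (s - t) / jacobiThetaPhi (s - t) :=
    strictAnti_logDeriv_jacobiThetaPhi (by linarith)
  rw [div_lt_div_iff₀ (jacobiThetaPhi_pos _) (jacobiThetaPhi_pos _)] at h
  linarith

lemma isAdmissibleKernel_associatedKernel (n : ℕ) :
    IsAdmissibleKernel (associatedKernel n jacobiThetaPhi) := by
  have hΦ := hasCubicDecay_jacobiThetaPhi
  have hK : HasCubicDecay (associatedKernel n jacobiThetaPhi) := hΦ.correlation n hΦ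
  refine ⟨hK.contDiff, fun t => ?_, fun t => ?_, fun t ht => ?_, 1, one_pos, hK.isBigO⟩
  · have hp (s : ℝ) : 0 < jacobiThetaPhi (s + t) * jacobiThetaPhi (s - t) :=
      mul_pos (jacobiThetaPhi_pos _) (jacobiThetaPhi_pos _)
    exact integral_pos_of_pos_off_zero (integrable_integrand n hΦ hΦ t)
      (fun s => mul_nonneg (hp s).le ((even_two_mul n).pow_nonneg s))
      fun s hs => mul_pos (hp s) ((even_two_mul n).pow_pos hs)
  · unfold associatedKernel
    refine integral_congr_ae (Filter.Eventually.of_forall fun s => ?_)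
    simp only [sub_neg_eq_add, ← sub_eq_add_neg]
    ring
  · have hd : deriv (associatedKernel n jacobiThetaPhi) t = _ :=
      (hasDerivAt_correlation n hΦ hΦ t).deriv
    have hi₁ := integrable_integrand n hΦ.deriv hΦ t
    have hi₂ := integrable_integrand n hΦ hΦ.deriv t
    rw [hd, correlation, correlation, ← neg_pos, neg_sub, ← integral_sub hi₂ hi₁]
    have hneg := fun s => deriv_mul_sub_mul_deriv_neg s ht
    refine integral_pos_of_pos_off_zero (hi₂.sub hi₁) (fun s => ?_) fun s hs => ?_
    · nlinarith [mul_nonneg (neg_nonneg.2 (hneg s).le) ((even_two_mul n).pow_nonneg s)]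
    · nlinarith [mul_pos (neg_pos.2 (hneg s)) ((even_two_mul n).pow_pos hs)]

theorem theorem4p5 :
    IsAdmissibleKernel jacobiThetaPhi ∧
      IsStrictlyLogConcaveKernel jacobiThetaPhi ∧
      ∀ n : ℕ, IsAdmissibleKernel (associatedKernel n jacobiThetaPhi) :=
  ⟨isAdmissibleKernel_jacobiThetaPhi, isStrictlyLogConcaveKernel_jacobiThetaPhi,
    isAdmissibleKernel_associatedKernel⟩
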